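/- Let $T$ be an acute triangle, identified with the set of its three vertices. Then for every coloring of the points of $\mathbb{R}^3$ (with the Euclidean metric) with an arbitrary, possibly infinite, number of colors, there is an isometric copy of $T$ in $\mathbb{R}^3$ (that is, a set $T' \subset \mathbb{R}^3$ admitting a distance-preserving bijection from $T$ onto $T'$) that is either monochromatic (all three points have the same color) or rainbow (the three points have pairwise different colors). -/

import Mathlib

/-- `A'` is an isometric copy of `A`: there is a distance-preserving bijection from `A` onto `A'`
(for the metrics inherited from the ambient spaces). -/
def IsIsometricCopy {X Y : Type*} [MetricSpace X] [MetricSpace Y] (A : Set X) (A' : Set Y) :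
    Prop :=
  Nonempty (A ≃ᵢ A')

/-- All points of `S` have the same color under `χ`. -/
def IsMonochromatic {X κ : Type*} (χ : X → κ) (S : Set X) : Prop :=
  ∀ x ∈ S, ∀ y ∈ S, χ x = χ y

/-- All points of `S` have pairwise different colors under `χ`. -/
def IsRainbow {X κ : Type*} (χ : X → κ) (S : Set X) : Prop :=
  ∀ x ∈ S, ∀ y ∈ S, x ≠ y → χ x ≠ χ y

/-! Suppose every copy of the triangle has exactly two colors. Being acute, it is the face of a
tetrahedron with equal opposite edges, whose four faces are all copies; such a tetrahedron must be
colored 2+2, so the colors of three vertices determine the fourth. Hence an apex and its mirror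
image in the base plane agree in color. Moving this pair by isometries, any two points at that
distance agree, so the coloring is constant, a contradiction. -/

/-- A family of points with the same pairwise distances as an injective family has as range an
isometric copy of the range of that family. -/
theorem isIsometricCopy_range {ι X Y : Type*} [MetricSpace X] [MetricSpace Y] {f : ι → X}
    (hf : Function.Injective f) {g : ι → Y} (h : ∀ i j, dist (g i) (g j) = dist (f i) (f j)) :
    IsIsometricCopy (Set.range f) (Set.range g) := by
  have hg : Function.Injective g := fun i j hij => hf <| by
    rw [← dist_eq_zero, ← h, hij, dist_self]
  refine ⟨⟨(Equiv.ofInjective f hf).symm.trans (Equiv.ofInjective g hg), ?_⟩⟩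
  refine Isometry.of_dist_eq ?_
  rintro ⟨_, i, rfl⟩ ⟨_, j, rfl⟩
  simp [Subtype.dist_eq, h]

/-- If no face of either of two tetrahedra with the common base `x y z` is monochromatic or
rainbow, then the two apexes have the same color. -/
theorem color_apex_eq {κ : Type*} {x y z w w' : κ}
    (h₀ : ¬(x = y ∧ y = z) ∧ ¬(x ≠ y ∧ y ≠ z ∧ x ≠ z))
    (h₁ : ¬(y = x ∧ x = w) ∧ ¬(y ≠ x ∧ x ≠ w ∧ y ≠ w))
    (h₂ : ¬(z = w ∧ w = x) ∧ ¬(z ≠ w ∧ w ≠ x ∧ z ≠ x))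
    (h₃ : ¬(w = z ∧ z = y) ∧ ¬(w ≠ z ∧ z ≠ y ∧ w ≠ y))
    (h₁' : ¬(y = x ∧ x = w') ∧ ¬(y ≠ x ∧ x ≠ w' ∧ y ≠ w'))
    (h₂' : ¬(z = w' ∧ w' = x) ∧ ¬(z ≠ w' ∧ w' ≠ x ∧ z ≠ x))
    (h₃' : ¬(w' = z ∧ z = y) ∧ ¬(w' ≠ z ∧ z ≠ y ∧ w' ≠ y)) : w = w' := by
  grind

/-- There is a triangle `x y z` with squared side lengths `α + β`, `α + γ`, `β + γ` which each of
two distinct points, `0` and `w'`, completes to a tetrahedron with equal opposite edges. -/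
theorem exists_equifacial_bipyramid {α β γ : ℝ} (hα : 0 < α) (hβ : 0 < β) (hγ : 0 < γ) :
    ∃ x y z w' : EuclideanSpace ℝ (Fin 3), w' ≠ 0 ∧
      dist x y = √(α + β) ∧ dist x z = √(α + γ) ∧ dist y z = √(β + γ) ∧
      dist 0 z = √(α + β) ∧ dist 0 y = √(α + γ) ∧ dist 0 x = √(β + γ) ∧
      dist w' z = √(α + β) ∧ dist w' y = √(α + γ) ∧ dist w' x = √(β + γ) := by
  obtain ⟨p, hp, rfl⟩ : ∃ p : ℝ, 0 < p ∧ p ^ 2 = α := ⟨√α, Real.sqrt_pos.2 hα, Real.sq_sqrt hα.le⟩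
  obtain ⟨q, hq, rfl⟩ : ∃ p : ℝ, 0 < p ∧ p ^ 2 = β := ⟨√β, Real.sqrt_pos.2 hβ, Real.sq_sqrt hβ.le⟩
  obtain ⟨r, hr, rfl⟩ : ∃ p : ℝ, 0 < p ∧ p ^ 2 = γ := ⟨√γ, Real.sqrt_pos.2 hγ, Real.sq_sqrt hγ.le⟩
  -- The tetrahedron is inscribed in a `p × q × r` box on alternate vertices. The scale `s` makes
  -- `w'` the reflection of `0` in the plane `X/p + Y/q + Z/r = 2` through `x`, `y`, `z`.
  set s : ℝ := 4 / ((q * r) ^ 2 + (p * r) ^ 2 + (p * q) ^ 2) with hs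
  have hsp : 0 < s := by positivity
  have hs' : s * ((q * r) ^ 2 + (p * r) ^ 2 + (p * q) ^ 2) = 4 := by
    rw [hs]; field_simp
  clear_value s
  refine ⟨!₂[0, q, r], !₂[p, 0, r], !₂[p, q, 0],
    !₂[s * (p * (q * r) ^ 2), s * (q * (p * r) ^ 2), s * (r * (p * q) ^ 2)], ?_, ?_⟩
  · intro h
    have := congrArg (fun v : EuclideanSpace ℝ (Fin 3) => v 0) h
    simp [hsp.ne', hp.ne', hq.ne', hr.ne'] at this
  · simp only [EuclideanSpace.dist_eq, Fin.sum_univ_three, Real.dist_eq, sq_abs]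
    refine ⟨?_, ?_, ?_, ?_, ?_, ?_, ?_, ?_, ?_⟩ <;> congr 1 <;> simp
    any_goals first | ring1 | linear_combination (s * (p * q * r) ^ 2) * hs'

/-- Every vector of norm at most `2 * l` is a sum of two vectors of norm `l`, in dimension at
least two. -/
theorem exists_add_eq_of_norm_le {E : Type*} [NormedAddCommGroup E] [InnerProductSpace ℝ E]
    [FiniteDimensional ℝ E] (hE : 1 < Module.finrank ℝ E) {l : ℝ} (hl : 0 ≤ l) {v : E}
    (hv : ‖v‖ ≤ 2 * l) : ∃ u w : E, ‖u‖ = l ∧ ‖w‖ = l ∧ u + w = v := by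
  have hne : (ℝ ∙ v)ᗮ ≠ ⊥ := by
    rw [Ne, Submodule.orthogonal_eq_bot_iff]
    intro h
    have := finrank_span_le_card (R := ℝ) ({v} : Set E)
    rw [h, finrank_top] at this
    simp at this
    omega
  obtain ⟨n, hn, hn0⟩ := Submodule.exists_mem_ne_zero_of_ne_bot hne
  rw [Submodule.mem_orthogonal_singleton_iff_inner_right] at hn
  have hn1 : ‖n‖ ≠ 0 := norm_ne_zero_iff.2 hn0
  -- `t • n` is the altitude of the isosceles triangle with base `v` and legs `l`.
  set t : ℝ := √(l ^ 2 - ‖v‖ ^ 2 / 4) / ‖n‖ with ht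
  have ht2 : t ^ 2 * ‖n‖ ^ 2 = l ^ 2 - ‖v‖ ^ 2 / 4 := by
    rw [← mul_pow, ht, div_mul_cancel₀ _ hn1, Real.sq_sqrt]
    nlinarith [norm_nonneg v]
  have key : ∀ s : ℝ, s ^ 2 = t ^ 2 → ‖(1 / 2 : ℝ) • v + s • n‖ = l := by
    intro s hs
    refine (sq_eq_sq₀ (norm_nonneg _) hl).1 ?_
    rw [norm_add_sq_real, norm_smul, norm_smul, mul_pow, mul_pow, inner_smul_left,
      inner_smul_right, hn]
    simp only [Real.norm_eq_abs, sq_abs, hs]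
    simp
    linarith
  refine ⟨(1 / 2 : ℝ) • v + t • n, (1 / 2 : ℝ) • v + (-t) • n, key _ rfl, key _ (neg_sq t), ?_⟩
  module

/-- A coloring of a space of dimension at least two, in which any two points at some fixed positive
distance have the same color, is constant. -/
theorem color_eq_of_forall_dist_eq {E κ : Type*} [NormedAddCommGroup E] [InnerProductSpace ℝ E]
    [FiniteDimensional ℝ E] (hE : 1 < Module.finrank ℝ E) {l : ℝ} (hl : 0 < l) {χ : E → κ}
    (h : ∀ x v, ‖v‖ = l → χ (x + v) = χ x) (x y : E) : χ x = χ y := by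
  have small : ∀ x v, ‖v‖ ≤ 2 * l → χ (x + v) = χ x := by
    intro x v hv
    obtain ⟨u, w, hu, hw, rfl⟩ := exists_add_eq_of_norm_le hE hl.le hv
    rw [← add_assoc, h _ _ hw, h _ _ hu]
  obtain ⟨n, hn⟩ := exists_nat_gt (‖x - y‖ / l)
  have hn0 : (0 : ℝ) < n := lt_of_le_of_lt (by positivity) hn
  have step : ∀ k : ℕ, χ (y + (k : ℝ) • ((n : ℝ)⁻¹ • (x - y))) = χ y := by
    intro k
    induction k with
    | zero => simp
    | succ k ih =>
      rw [Nat.cast_succ, add_smul, one_smul, ← add_assoc, small _ _ _, ih]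
      rw [norm_smul, Real.norm_eq_abs, abs_of_pos (inv_pos.2 hn0), inv_mul_le_iff₀ hn0]
      rw [div_lt_iff₀ hl] at hn
      nlinarith
  have := step n
  rwa [smul_inv_smul₀ hn0.ne', add_sub_cancel] at this

theorem theorem2 {d : ℕ} (T : Affine.Triangle ℝ (EuclideanSpace ℝ (Fin d)))
    (hT : T.AcuteAngled) {κ : Type*} (χ : EuclideanSpace ℝ (Fin 3) → κ) :
    ∃ T' : Set (EuclideanSpace ℝ (Fin 3)),
      IsIsometricCopy (Set.range T.points) T' ∧ (IsMonochromatic χ T' ∨ IsRainbow χ T') := by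
  by_contra hcon
  have inner_pos : ∀ i j k : Fin 3, i ≠ j → i ≠ k → j ≠ k →
      0 < inner ℝ (T.points i - T.points j) (T.points k - T.points j) := by
    intro i j k hij hik hjk
    have := hT i j k hij hik hjk
    rw [EuclideanGeometry.angle, InnerProductGeometry.angle, Real.arccos_lt_pi_div_two] at this
    exact pos_of_mul_pos_left this (by positivity)
  -- Acuteness makes these three numbers positive; they are the squared edges of the box.
  set α := inner ℝ (T.points 1 - T.points 0) (T.points 2 - T.points 0) with hα
  set β := inner ℝ (T.points 0 - T.points 1) (T.points 2 - T.points 1) with hβ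
  set γ := inner ℝ (T.points 0 - T.points 2) (T.points 1 - T.points 2) with hγ
  have sides : dist (T.points 0) (T.points 1) = √(α + β) ∧
      dist (T.points 0) (T.points 2) = √(α + γ) ∧ dist (T.points 1) (T.points 2) = √(β + γ) := by
    refine ⟨?_, ?_, ?_⟩ <;>
    · rw [dist_eq_norm, norm_eq_sqrt_real_inner]
      congr 1
      simp only [hα, hβ, hγ, inner_sub_left, inner_sub_right]
      rw [real_inner_comm (T.points 1) (T.points 0), real_inner_comm (T.points 2) (T.points 0),
        real_inner_comm (T.points 2) (T.points 1)]
      ring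
  have faces : ∀ x y z : EuclideanSpace ℝ (Fin 3), dist x y = √(α + β) → dist x z = √(α + γ) →
      dist y z = √(β + γ) → ¬(χ x = χ y ∧ χ y = χ z) ∧ ¬(χ x ≠ χ y ∧ χ y ≠ χ z ∧ χ x ≠ χ z) := by
    intro x y z hxy hxz hyz
    have hcopy : IsIsometricCopy (Set.range T.points) (Set.range ![x, y, z]) := by
      refine isIsometricCopy_range T.independent.injective fun i j => ?_
      fin_cases i <;> fin_cases j <;> simp [sides, hxy, hxz, hyz, dist_comm y x, dist_comm z x,
        dist_comm z y, dist_comm (T.points 1) (T.points 0), dist_comm (T.points 2) (T.points 0),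
        dist_comm (T.points 2) (T.points 1)]
    constructor
    · rintro ⟨h₁, h₂⟩
      refine hcon ⟨_, hcopy, Or.inl ?_⟩
      rintro _ ⟨i, rfl⟩ _ ⟨j, rfl⟩
      fin_cases i <;> fin_cases j <;> simp [h₁, h₂]
    · rintro ⟨h₁, h₂, h₃⟩
      refine hcon ⟨_, hcopy, Or.inr ?_⟩
      rintro _ ⟨i, rfl⟩ _ ⟨j, rfl⟩
      fin_cases i <;> fin_cases j <;> simp [h₁, h₂, h₃, h₁.symm, h₂.symm, h₃.symm]
  obtain ⟨x, y, z, w, hw, hxy, hxz, hyz, hz, hy, hx, hwz, hwy, hwx⟩ :=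
    exists_equifacial_bipyramid (inner_pos 1 0 2 (by decide) (by decide) (by decide))
      (inner_pos 0 1 2 (by decide) (by decide) (by decide))
      (inner_pos 0 2 1 (by decide) (by decide) (by decide))
  have period : ∀ u v : EuclideanSpace ℝ (Fin 3), ‖v‖ = ‖w‖ → χ (u + v) = χ u := by
    intro u v hv
    obtain ⟨f, hf0, hfw⟩ : ∃ f : EuclideanSpace ℝ (Fin 3) ≃ᵢ EuclideanSpace ℝ (Fin 3),
        f 0 = u ∧ f w = u + v := by
      -- As `‖v‖ = ‖w‖`, reflecting in the hyperplane orthogonal to `w - v` fixes `0` and takes `w`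
      -- to `v`.
      refine ⟨((ℝ ∙ (w - v))ᗮ.reflection.toIsometryEquiv).trans (IsometryEquiv.addLeft u), ?_, ?_⟩
      · simp
      · simp [Submodule.reflection_sub hv.symm]
    rw [← hfw, ← hf0]
    symm
    apply color_apex_eq (faces (f x) (f y) (f z) _ _ _) (faces (f y) (f x) (f 0) _ _ _)
      (faces (f z) (f 0) (f x) _ _ _) (faces (f 0) (f z) (f y) _ _ _)
      (faces (f y) (f x) (f w) _ _ _) (faces (f z) (f w) (f x) _ _ _)
      (faces (f w) (f z) (f y) _ _ _)
    all_goals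
      rw [f.isometry.dist_eq]
      first | assumption | (rw [dist_comm]; assumption)
  have const := color_eq_of_forall_dist_eq (by simp) (norm_pos_iff.2 hw) period
  exact (faces x y z hxy hxz hyz).1 ⟨const _ _, const _ _⟩
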